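/- Let $X$ be a finite connected (nonempty) graph in the sense of Serre, so that every oriented edge $e$ has a terminal vertex $t(e)$ and an inverse edge $\bar e\neq e$, and let $\mathcal G$ be a graph of groups over $X$, with vertex groups $G_x$, edge groups $G_e=G_{\bar e}$ and injective homomorphisms $i_e\colon G_e\hookrightarrow G_{t(e)}$. Assume that all vertex groups and all edge groups are infinite cyclic. Choose generators $z_x$ of $G_x$ and $z_e=z_{\bar e}$ of $G_e$, and let $n_e\in\mathbb Z$ be given by $i_e(z_e)=z_{t(e)}^{n_e}$. Assume that $\mathcal G$ is balanced, i.e. that \[\prod_{i=1}^m n_{e_i}=\prod_{i=1}^m n_{\overline{e_i}}\] for every closed edge loop $e_1,\dots,e_m$ in $X$ (this does not depend on the choice of the generators). For a maximal tree $T\subset X$ and a set $L$ containing exactly one orientation of each edge outside $T$, the fundamental group $\pi_1(\mathcal G)$ is the quotient of the free product of all the $G_x$ and of the free group on $\{t_e : e\in L\}$ by the relations $i_e(g)=i_{\bar e}(g)$ for $e\in T$, $g\in G_e$, and $t_e\, i_e(g)\, t_e^{-1}=i_{\bar e}(g)$ for $e\in L$, $g\in G_e$. Then, for every choice of $T$ and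 $L$, there is a central infinite cyclic subgroup $N\le \pi_1(\mathcal G)$ such that $\pi_1(\mathcal G)/N$ is isomorphic to the fundamental group of a graph of groups over a finite connected graph all of whose vertex groups and edge groups are finite. -/

import Mathlib

universe u v w z

/-- A graph in the sense of Serre (loops and multiple edges are allowed). `E` is the set of
geometric edges; every geometric edge `e` carries the two mutually inverse oriented edges
`(e, true)` and `(e, false)`, and `tgt` gives the terminal vertex of an oriented edge. -/
structure SerreGraph where
  V : Type u
  E : Type v
  tgt : E × Bool → V

namespace SerreGraph

/-- The inverse of an oriented edge. -/
def bar {X : SerreGraph.{u, v}} (e : X.E × Bool) : X.E × Bool := (e.1, !e.2)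

/-- The initial vertex of an oriented edge. -/
def src (X : SerreGraph.{u, v}) (e : X.E × Bool) : X.V := X.tgt (bar e)

/-- `X.IsPath a b l`: the list `l` of oriented edges is an edge path from `a` to `b`. -/
def IsPath (X : SerreGraph.{u, v}) : X.V → X.V → List (X.E × Bool) → Prop
  | a, b, [] => a = b
  | a, b, e :: l => X.src e = a ∧ IsPath X (X.tgt e) b l

/-- An edge path without backtracking. -/
def IsReduced {X : SerreGraph.{u, v}} (l : List (X.E × Bool)) : Prop :=
  l.IsChain (fun e f => f ≠ bar e)

/-- Connected graphs (in particular nonempty). -/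
def Connected (X : SerreGraph.{u, v}) : Prop :=
  Nonempty X.V ∧ ∀ a b : X.V, ∃ l, X.IsPath a b l

/-- The geometric edges in `T`, together with all vertices, form a tree: a nonempty connected
graph in which every closed path without backtracking is empty. For a connected graph these are
precisely the (edge sets of the) maximal subtrees. -/
structure IsMaximalTree (X : SerreGraph.{u, v}) (T : Set X.E) : Prop where
  nonempty : Nonempty X.V
  exists_path : ∀ a b : X.V, ∃ l, X.IsPath a b l ∧ ∀ e ∈ l, e.1 ∈ T
  eq_nil : ∀ (a : X.V) (l : List (X.E × Bool)),
    X.IsPath a a l → (∀ e ∈ l, e.1 ∈ T) → IsReduced l → l = []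

end SerreGraph

/-- A graph of groups over the graph `X`: groups `G_x` for vertices `x`, groups `G_e = G_{ē}` for
edges, and an injective homomorphism `i_e : G_e → G_{t(e)}` for every oriented edge `e`. -/
structure GraphOfGroups (X : SerreGraph.{u, v}) where
  vertexGroup : X.V → Type w
  edgeGroup : X.E → Type z
  [instVertex : ∀ x, Group (vertexGroup x)]
  [instEdge : ∀ e, Group (edgeGroup e)]
  incl : ∀ e : X.E × Bool, edgeGroup e.1 →* vertexGroup (X.tgt e)
  incl_injective : ∀ e, Function.Injective (incl e)

namespace GraphOfGroups

attribute [instance] GraphOfGroups.instVertex GraphOfGroups.instEdge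

variable {X : SerreGraph.{u, v}}

/-- Balancedness, for a graph of groups whose vertex groups are trivial or infinite cyclic:
for generators `zV x` of the vertex groups and `zE e` of the edge groups, and integers `n e` with
`i_e (z_e) = z_{t(e)} ^ n_e`, every closed edge loop with infinite edge groups satisfies
`∏ n_{e_i} = ∏ n_{ē_i}`. (This does not depend on the choice of the generators.) -/
def IsBalanced (G : GraphOfGroups.{u, v, w, z} X) : Prop :=
  ∀ (zV : ∀ x, G.vertexGroup x) (zE : ∀ e, G.edgeGroup e) (n : X.E × Bool → ℤ),
    (∀ x, Subgroup.zpowers (zV x) = ⊤) →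
    (∀ e, Subgroup.zpowers (zE e) = ⊤) →
    (∀ e : X.E × Bool, G.incl e (zE e.1) = zV (X.tgt e) ^ n e) →
    ∀ (a : X.V) (l : List (X.E × Bool)), X.IsPath a a l →
      (∀ e ∈ l, Infinite (G.edgeGroup e.1)) →
      (l.map n).prod = (l.map (fun e => n (SerreGraph.bar e))).prod

/-- The free product of all vertex groups and of the free group on the geometric edges
outside `T`. -/
abbrev FreeProd (G : GraphOfGroups.{u, v, w, z} X) (T : Set X.E) :=
  Monoid.Coprod (Monoid.CoprodI G.vertexGroup) (FreeGroup {e : X.E // e ∉ T})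

/-- The vertex group `G_x` in the free product. -/
def ofVertex (G : GraphOfGroups.{u, v, w, z} X) (T : Set X.E) (x : X.V) :
    G.vertexGroup x →* G.FreeProd T :=
  Monoid.Coprod.inl.comp Monoid.CoprodI.of

/-- The stable letter `t_e` of an edge `e` outside `T`. -/
def stable (G : GraphOfGroups.{u, v, w, z} X) (T : Set X.E) (e : {e : X.E // e ∉ T}) :
    G.FreeProd T :=
  Monoid.Coprod.inr (FreeGroup.of e)

/-- The relators of the fundamental group: `i_e(g) = i_{ē}(g)` for `e` in `T`, and
`t_e i_e(g) t_e⁻¹ = i_{ē}(g)` for each edge outside `T` with its chosen orientation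
`(e, o e)`. -/
def relators (G : GraphOfGroups.{u, v, w, z} X) (T : Set X.E) (o : {e : X.E // e ∉ T} → Bool) :
    Set (G.FreeProd T) :=
  {r | ∃ e ∈ T, ∃ g : G.edgeGroup e,
      r = G.ofVertex T _ (G.incl (e, true) g) * (G.ofVertex T _ (G.incl (e, false) g))⁻¹} ∪
  {r | ∃ (e : {e : X.E // e ∉ T}) (g : G.edgeGroup e.1),
      r = G.stable T e * G.ofVertex T _ (G.incl (e.1, o e) g) * (G.stable T e)⁻¹ *
        (G.ofVertex T _ (G.incl (e.1, !o e) g))⁻¹}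

/-- The fundamental group of a graph of groups, with respect to a maximal tree `T` and an
orientation `o` of the edges outside `T`. -/
abbrev FundamentalGroup (G : GraphOfGroups.{u, v, w, z} X) (T : Set X.E)
    (o : {e : X.E // e ∉ T} → Bool) :=
  G.FreeProd T ⧸ Subgroup.normalClosure (G.relators T o)

end GraphOfGroups

namespace SerreGraph

variable {X : SerreGraph.{u, v}}

@[simp] theorem bar_bar (e : X.E × Bool) : bar (bar e) = e := by simp [bar]

theorem IsPath.append {a b c : X.V} {l m : List (X.E × Bool)}
    (hl : X.IsPath a b l) (hm : X.IsPath b c m) : X.IsPath a c (l ++ m) := by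
  induction l generalizing a with
  | nil => cases hl; exact hm
  | cons e l ih => exact ⟨hl.1, ih hl.2⟩

theorem IsPath.reverse {a b : X.V} {l : List (X.E × Bool)}
    (hl : X.IsPath a b l) : X.IsPath b a (l.map bar).reverse := by
  induction l generalizing a with
  | nil => exact Eq.symm hl
  | cons e l ih =>
    rw [List.map_cons, List.reverse_cons]
    refine (ih hl.2).append ⟨?_, hl.1⟩
    simp [src]

/-- A function that is constant along the edges of a maximal tree is constant. -/
theorem IsMaximalTree.eq_of_forall_edge {T : Set X.E} (hT : X.IsMaximalTree T) {α : Type*}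
    (f : X.V → α) (hf : ∀ e ∈ T, f (X.tgt (e, true)) = f (X.tgt (e, false))) (a b : X.V) :
    f a = f b := by
  obtain ⟨l, hl, hlT⟩ := hT.exists_path a b
  induction l generalizing a with
  | nil => exact congrArg f hl
  | cons e l ih =>
    rw [← ih _ hl.2 fun e' he' => hlT e' (List.mem_cons_of_mem _ he'), ← hl.1]
    have := hf e.1 (hlT e List.mem_cons_self)
    obtain ⟨e, _ | _⟩ := e
    · exact this
    · exact this.symm

end SerreGraph

namespace GraphOfGroups

variable {X : SerreGraph.{u, v}} {G : GraphOfGroups.{u, v, w, z} X} {T : Set X.E}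
  {o : {e : X.E // e ∉ T} → Bool}

/-- The homomorphism from a vertex group to the fundamental group. -/
def vertexHom (G : GraphOfGroups.{u, v, w, z} X) (T : Set X.E)
    (o : {e : X.E // e ∉ T} → Bool) (x : X.V) : G.vertexGroup x →* G.FundamentalGroup T o :=
  (QuotientGroup.mk' _).comp (G.ofVertex T x)

/-- The stable letter of an edge outside `T` in the fundamental group. -/
def letter (G : GraphOfGroups.{u, v, w, z} X) (T : Set X.E)
    (o : {e : X.E // e ∉ T} → Bool) (e : {e : X.E // e ∉ T}) : G.FundamentalGroup T o :=
  QuotientGroup.mk' _ (G.stable T e)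

theorem vertexHom_incl_of_mem {e : X.E} (he : e ∈ T) (g : G.edgeGroup e) :
    G.vertexHom T o _ (G.incl (e, true) g) = G.vertexHom T o _ (G.incl (e, false) g) := by
  rw [← mul_inv_eq_one, vertexHom, vertexHom]
  refine (QuotientGroup.eq_one_iff
    (N := Subgroup.normalClosure (G.relators T o)) (_ * _⁻¹)).2 ?_
  exact Subgroup.subset_normalClosure (Or.inl ⟨e, he, g, rfl⟩)

theorem letter_mul_vertexHom_incl (e : {e : X.E // e ∉ T}) (g : G.edgeGroup e.1) :
    G.letter T o e * G.vertexHom T o _ (G.incl (e.1, o e) g) * (G.letter T o e)⁻¹ =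
      G.vertexHom T o _ (G.incl (e.1, !o e) g) := by
  rw [← mul_inv_eq_one, vertexHom, vertexHom, letter]
  refine (QuotientGroup.eq_one_iff
    (N := Subgroup.normalClosure (G.relators T o)) (_ * _ * _⁻¹ * _⁻¹)).2 ?_
  exact Subgroup.subset_normalClosure (Or.inr ⟨e, g, rfl⟩)

/-- The universal property of the fundamental group. -/
def lift {K : Type*} [Group K] (f : ∀ x, G.vertexGroup x →* K) (s : {e : X.E // e ∉ T} → K)
    (h₁ : ∀ e ∈ T, ∀ g : G.edgeGroup e, f _ (G.incl (e, true) g) = f _ (G.incl (e, false) g))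
    (h₂ : ∀ (e : {e : X.E // e ∉ T}) (g : G.edgeGroup e.1),
      s e * f _ (G.incl (e.1, o e) g) * (s e)⁻¹ = f _ (G.incl (e.1, !o e) g)) :
    G.FundamentalGroup T o →* K :=
  QuotientGroup.lift _ (Monoid.Coprod.lift (Monoid.CoprodI.lift f) (FreeGroup.lift s)) <| by
    refine Subgroup.normalClosure_le_normal ?_
    rintro r (⟨e, he, g, rfl⟩ | ⟨e, g, rfl⟩)
    · simp [ofVertex, h₁ e he g]
    · simp [ofVertex, stable, h₂ e g]

section lift

variable {K : Type*} [Group K] (f : ∀ x, G.vertexGroup x →* K) (s : {e : X.E // e ∉ T} → K)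
    (h₁ : ∀ e ∈ T, ∀ g : G.edgeGroup e, f _ (G.incl (e, true) g) = f _ (G.incl (e, false) g))
    (h₂ : ∀ (e : {e : X.E // e ∉ T}) (g : G.edgeGroup e.1),
      s e * f _ (G.incl (e.1, o e) g) * (s e)⁻¹ = f _ (G.incl (e.1, !o e) g))

@[simp] theorem lift_vertexHom (x : X.V) (g : G.vertexGroup x) :
    lift f s h₁ h₂ (G.vertexHom T o x g) = f x g := by
  change Monoid.Coprod.lift (Monoid.CoprodI.lift f) (FreeGroup.lift s) (G.ofVertex T x g) = _
  simp [ofVertex]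

@[simp] theorem lift_letter (e : {e : X.E // e ∉ T}) :
    lift f s h₁ h₂ (G.letter T o e) = s e := by
  change Monoid.Coprod.lift (Monoid.CoprodI.lift f) (FreeGroup.lift s) (G.stable T e) = _
  simp [stable]

end lift

theorem hom_ext {K : Type*} [Monoid K] {φ ψ : G.FundamentalGroup T o →* K}
    (hv : ∀ x g, φ (G.vertexHom T o x g) = ψ (G.vertexHom T o x g))
    (hs : ∀ e, φ (G.letter T o e) = ψ (G.letter T o e)) : φ = ψ := by
  refine QuotientGroup.monoidHom_ext _ (Monoid.Coprod.hom_ext ?_ ?_)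
  · exact Monoid.CoprodI.ext_hom _ _ fun x => MonoidHom.ext fun g => hv x g
  · exact FreeGroup.ext_hom _ _ hs

/-- An element commuting with the vertex groups and the stable letters is central. -/
theorem mem_center_of_commute {c : G.FundamentalGroup T o}
    (hv : ∀ x g, Commute c (G.vertexHom T o x g)) (hs : ∀ e, Commute c (G.letter T o e)) :
    c ∈ Subgroup.center (G.FundamentalGroup T o) := by
  have h : (MulAut.conj c).toMonoidHom = MonoidHom.id (G.FundamentalGroup T o) := by
    refine hom_ext (fun x g => ?_) fun e => ?_
    · simpa using mul_inv_eq_of_eq_mul (hv x g).eq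
    · simpa using mul_inv_eq_of_eq_mul (hs e).eq
  refine Subgroup.mem_center_iff.2 fun g => ?_
  have := DFunLike.congr_fun h g
  exact (mul_inv_eq_iff_eq_mul.1 (by simpa using this)).symm

/-- The quotient of a graph of groups by a compatible family of normal subgroups. -/
def quotient (G : GraphOfGroups.{u, v, w, z} X) (C : ∀ x, Subgroup (G.vertexGroup x))
    (D : ∀ e, Subgroup (G.edgeGroup e)) [∀ x, (C x).Normal] [∀ e, (D e).Normal]
    (h : ∀ e : X.E × Bool, D e.1 = (C (X.tgt e)).comap (G.incl e)) :
    GraphOfGroups.{u, v, w, z} X where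
  vertexGroup x := G.vertexGroup x ⧸ C x
  edgeGroup e := G.edgeGroup e ⧸ D e
  incl e := QuotientGroup.map _ _ (G.incl e) (h e).le
  incl_injective e := by
    refine (injective_iff_map_eq_one _).2 fun q hq => ?_
    obtain ⟨g, rfl⟩ := QuotientGroup.mk_surjective q
    rw [QuotientGroup.map_mk, QuotientGroup.eq_one_iff] at hq
    rw [QuotientGroup.eq_one_iff, h e]
    exact hq

section quotient

variable (C : ∀ x, Subgroup (G.vertexGroup x)) (D : ∀ e, Subgroup (G.edgeGroup e))
  [∀ x, (C x).Normal] [∀ e, (D e).Normal]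
  (h : ∀ e : X.E × Bool, D e.1 = (C (X.tgt e)).comap (G.incl e))

/-- The projection from a vertex group to the vertex group of the quotient. -/
def quotientMk (x : X.V) : G.vertexGroup x →* (G.quotient C D h).vertexGroup x :=
  QuotientGroup.mk' (C x)

/-- The homomorphism of fundamental groups induced by passing to the quotient graph of groups. -/
def toQuotient (T : Set X.E) (o : {e : X.E // e ∉ T} → Bool) :
    G.FundamentalGroup T o →* (G.quotient C D h).FundamentalGroup T o :=
  lift (fun x => ((G.quotient C D h).vertexHom T o x).comp (quotientMk C D h x))
    ((G.quotient C D h).letter T o)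
    (fun e he g => vertexHom_incl_of_mem (G := G.quotient C D h) he (g : G.edgeGroup e ⧸ D e))
    (fun e g => letter_mul_vertexHom_incl (G := G.quotient C D h) e
      (g : G.edgeGroup e.1 ⧸ D e.1))

theorem toQuotient_vertexHom (x : X.V) (g : G.vertexGroup x) :
    toQuotient C D h T o (G.vertexHom T o x g) =
      (G.quotient C D h).vertexHom T o x (quotientMk C D h x g) :=
  lift_vertexHom ..

theorem toQuotient_letter (e : {e : X.E // e ∉ T}) :
    toQuotient C D h T o (G.letter T o e) = (G.quotient C D h).letter T o e :=
  lift_letter ..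

variable (N : Subgroup (G.FundamentalGroup T o)) [N.Normal]
  (hC : ∀ x, C x ≤ N.comap (G.vertexHom T o x))

/-- The homomorphism from the fundamental group of the quotient graph of groups to the quotient of
the fundamental group by a normal subgroup containing the images of the subgroups `C x`. -/
def fromQuotient : (G.quotient C D h).FundamentalGroup T o →* G.FundamentalGroup T o ⧸ N :=
  lift (G := G.quotient C D h) (fun x => QuotientGroup.map (C x) N (G.vertexHom T o x) (hC x))
    (fun e => QuotientGroup.mk' N (G.letter T o e))
    (fun e he q => by
      obtain ⟨g, rfl⟩ := QuotientGroup.mk_surjective q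
      exact congrArg (QuotientGroup.mk' N) (vertexHom_incl_of_mem he g))
    (fun e q => by
      obtain ⟨g, rfl⟩ := QuotientGroup.mk_surjective q
      exact congrArg (QuotientGroup.mk' N) (letter_mul_vertexHom_incl e g))

theorem fromQuotient_vertexHom (x : X.V) (g : G.vertexGroup x) :
    fromQuotient C D h N hC ((G.quotient C D h).vertexHom T o x (quotientMk C D h x g)) =
      QuotientGroup.mk' N (G.vertexHom T o x g) :=
  lift_vertexHom (G := G.quotient C D h) ..

theorem fromQuotient_letter (e : {e : X.E // e ∉ T}) :
    fromQuotient C D h N hC ((G.quotient C D h).letter T o e) =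
      QuotientGroup.mk' N (G.letter T o e) :=
  lift_letter (G := G.quotient C D h) ..

/-- The quotient of the fundamental group by a normal subgroup `N` that contains the images of the
subgroups `C x` and dies in the fundamental group of the quotient graph of groups. -/
def quotientEquiv (hN : N ≤ (toQuotient C D h T o).ker) :
    (G.FundamentalGroup T o ⧸ N) ≃* (G.quotient C D h).FundamentalGroup T o :=
  MonoidHom.toMulEquiv
    (QuotientGroup.lift N (toQuotient C D h T o) hN)
    (fromQuotient C D h N hC)
    (QuotientGroup.monoidHom_ext _ <| hom_ext
      (fun x g => (congrArg (fromQuotient C D h N hC) (toQuotient_vertexHom C D h x g)).trans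
        (fromQuotient_vertexHom C D h N hC x g))
      (fun e => (congrArg (fromQuotient C D h N hC) (toQuotient_letter C D h e)).trans
        (fromQuotient_letter C D h N hC e)))
    (hom_ext
      (fun x q => by
        obtain ⟨g, rfl⟩ : ∃ g, quotientMk C D h x g = q := QuotientGroup.mk_surjective q
        exact (congrArg (QuotientGroup.lift N (toQuotient C D h T o) hN)
          (fromQuotient_vertexHom C D h N hC x g)).trans (toQuotient_vertexHom C D h x g))
      (fun e => (congrArg (QuotientGroup.lift N (toQuotient C D h T o) hN)
          (fromQuotient_letter C D h N hC e)).trans (toQuotient_letter C D h e)))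

end quotient

/-- If nonzero integers on the oriented edges are balanced along all closed paths, then they are the
quotients of nonzero integer weights on the vertices and on the geometric edges. -/
theorem exists_weights (hX : X.Connected) [Finite X.V] [Finite X.E] (n : X.E × Bool → ℤ)
    (hn : ∀ e, n e ≠ 0)
    (hbal : ∀ (a : X.V) (l : List (X.E × Bool)), X.IsPath a a l →
      (l.map n).prod = (l.map (fun e => n (SerreGraph.bar e))).prod) :
    ∃ (d : X.V → ℤ) (k : X.E → ℤ), (∀ x, d x ≠ 0) ∧ (∀ e, k e ≠ 0) ∧
      ∀ e : X.E × Bool, d (X.tgt e) = n e * k e.1 := by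
  obtain ⟨⟨a⟩, hpath⟩ := hX
  choose p hp using hpath a
  let r : List (X.E × Bool) → ℚ := fun l => (l.map fun e => (n e : ℚ) / n (SerreGraph.bar e)).prod
  have hr0 (l) : r l ≠ 0 := by
    simp [r, List.prod_eq_zero_iff, hn]
  have hr_append (l m) : r (l ++ m) = r l * r m := by simp [r]
  have hr_rev (l : List (X.E × Bool)) : r (l.map SerreGraph.bar).reverse = (r l)⁻¹ := by
    induction l with
    | nil => simp [r]
    | cons e l ih =>
      rw [List.map_cons, List.reverse_cons, hr_append, ih]
      simp [r, mul_comm]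
  have hr_div (l : List (X.E × Bool)) : r l = ((l.map n).prod : ℤ) /
      ((l.map (fun e => n (SerreGraph.bar e))).prod : ℤ) := by
    induction l with
    | nil => simp [r]
    | cons e l ih =>
      rw [show r (e :: l) = (n e : ℚ) / n (SerreGraph.bar e) * r l by simp [r], ih]
      simp only [List.map_cons, List.prod_cons, Int.cast_mul]
      rw [div_mul_div_comm]
  have hr_loop (l b) (hl : X.IsPath b b l) : r l = 1 := by
    rw [hr_div, hbal b l hl]
    refine div_self (Int.cast_ne_zero.2 ?_)
    simp [List.prod_eq_zero_iff, hn]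
  have hstep (e : X.E × Bool) :
      r (p (X.tgt e)) / n e = r (p (X.src e)) / n (SerreGraph.bar e) := by
    have hl : X.IsPath a a (p (X.src e) ++ ([e] ++ ((p (X.tgt e)).map SerreGraph.bar).reverse)) :=
      (hp _).append (SerreGraph.IsPath.append (b := X.tgt e) ⟨rfl, rfl⟩ (hp _).reverse)
    have h := hr_loop _ _ hl
    rw [hr_append, hr_append, hr_rev, show r [e] = (n e : ℚ) / n (SerreGraph.bar e) by simp [r]]
      at h
    have h0 := hr0 (p (X.tgt e))
    have h1 : (n e : ℚ) ≠ 0 := Int.cast_ne_zero.2 (hn e)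
    have h2 : (n (SerreGraph.bar e) : ℚ) ≠ 0 := Int.cast_ne_zero.2 (hn _)
    field_simp at h ⊢
    linarith
  obtain ⟨⟨b, hb⟩, hbi⟩ := IsLocalization.exist_integer_multiples_of_finite (nonZeroDivisors ℤ)
    (Sum.elim (fun x => r (p x)) fun e => r (p (X.tgt (e, true))) / n (e, true))
  have hb0 : (b : ℚ) ≠ 0 := Int.cast_ne_zero.2 (nonZeroDivisors.ne_zero hb)
  choose d hd using fun x => hbi (Sum.inl x)
  choose k hk using fun e => hbi (Sum.inr e)
  simp only [Sum.elim_inl, Sum.elim_inr, eq_intCast, zsmul_eq_mul] at hd hk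
  refine ⟨d, k, fun x hx => ?_, fun e he => ?_, fun e => ?_⟩
  · have := hd x
    rw [hx, Int.cast_zero] at this
    exact mul_ne_zero hb0 (hr0 _) this.symm
  · have := hk e
    rw [he, Int.cast_zero] at this
    exact mul_ne_zero hb0 (div_ne_zero (hr0 _) (Int.cast_ne_zero.2 (hn _))) this.symm
  · have h1 : (n e : ℚ) ≠ 0 := Int.cast_ne_zero.2 (hn e)
    have key : r (p (X.tgt (e.1, true))) / n (e.1, true) = r (p (X.tgt e)) / n e := by
      obtain ⟨e, _ | _⟩ := e
      · exact hstep (e, true)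
      · rfl
    refine Int.cast_injective (α := ℚ) ?_
    rw [Int.cast_mul, hd, hk, key]
    field_simp

end GraphOfGroups

theorem Subgroup.zpowers_normal_of_zpowers_eq_top {K : Type*} [Group K] {a : K}
    (ha : Subgroup.zpowers a = ⊤) (d : ℤ) : (Subgroup.zpowers (a ^ d)).Normal := by
  refine ⟨fun g hg b => ?_⟩
  obtain ⟨i, rfl⟩ := Subgroup.mem_zpowers_iff.1 (ha ▸ Subgroup.mem_top g : g ∈ zpowers a)
  obtain ⟨j, rfl⟩ := Subgroup.mem_zpowers_iff.1 (ha ▸ Subgroup.mem_top b : b ∈ zpowers a)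
  rwa [((Commute.refl a).zpow_zpow j i).eq, mul_inv_cancel_right]

theorem finite_quotient_zpowers_of_zpowers_eq_top {K : Type*} [Group K] {a : K}
    (ha : Subgroup.zpowers a = ⊤) {d : ℤ} (hd : d ≠ 0) :
    Finite (K ⧸ Subgroup.zpowers (a ^ d)) := by
  have := Subgroup.zpowers_normal_of_zpowers_eq_top ha d
  have hfin : IsOfFinOrder (a : K ⧸ Subgroup.zpowers (a ^ d)) := by
    refine isOfFinOrder_iff_zpow_eq_one.2 ⟨d, hd, ?_⟩
    rw [← QuotientGroup.mk_zpow, QuotientGroup.eq_one_iff]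
    exact Subgroup.mem_zpowers _
  have htop : Subgroup.zpowers (a : K ⧸ Subgroup.zpowers (a ^ d)) = ⊤ := by
    have h := MonoidHom.map_zpowers (QuotientGroup.mk' (Subgroup.zpowers (a ^ d))) a
    rw [ha, ← MonoidHom.range_eq_map, QuotientGroup.range_mk'] at h
    exact h.symm
  have := hfin.finite_zpowers
  rw [htop] at this
  exact Set.finite_univ_iff.1 (by simpa using this)

theorem mainTheorem6 (X : SerreGraph.{u, v}) (hXV : Finite X.V) (hXE : Finite X.E)
    (hX : X.Connected) (G : GraphOfGroups.{u, v, w, z} X)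
    (hV : ∀ x, IsCyclic (G.vertexGroup x) ∧ Infinite (G.vertexGroup x))
    (hE : ∀ e, IsCyclic (G.edgeGroup e) ∧ Infinite (G.edgeGroup e))
    (hG : G.IsBalanced)
    (T : Set X.E) (hT : X.IsMaximalTree T) (o : {e : X.E // e ∉ T} → Bool) :
    ∃ N : Subgroup (G.FundamentalGroup T o),
      N ≤ Subgroup.center (G.FundamentalGroup T o) ∧ IsCyclic N ∧ Infinite N ∧
      ∃ _ : N.Normal,
      ∃ (Y : SerreGraph.{u, v}) (H : GraphOfGroups.{u, v, w, z} Y) (T' : Set Y.E)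
        (o' : {e : Y.E // e ∉ T'} → Bool),
        Finite Y.V ∧ Finite Y.E ∧ Y.Connected ∧
        (∀ y, Finite (H.vertexGroup y)) ∧ (∀ e, Finite (H.edgeGroup e)) ∧
        Y.IsMaximalTree T' ∧
        Nonempty ((G.FundamentalGroup T o ⧸ N) ≃* H.FundamentalGroup T' o') := by
  choose zV hzV using fun x => ((hV x).1).exists_zpow_surjective
  choose zE hzE using fun e => ((hE e).1).exists_zpow_surjective
  have hzVt (x) : Subgroup.zpowers (zV x) = ⊤ := (Subgroup.eq_top_iff' _).2 (hzV x)
  have hzEt (e) : Subgroup.zpowers (zE e) = ⊤ := (Subgroup.eq_top_iff' _).2 (hzE e)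
  have hinjE (e) : Function.Injective fun i : ℤ => zE e ^ i := by
    have := (hE e).2
    rw [injective_zpow_iff_not_isOfFinOrder, ← orderOf_eq_zero_iff]
    exact Infinite.orderOf_eq_zero_of_forall_mem_zpowers (hzE e)
  choose n hn using fun e : X.E × Bool => hzV _ (G.incl e (zE e.1))
  replace hn (e : X.E × Bool) : G.incl e (zE e.1) = zV (X.tgt e) ^ n e := (hn e).symm
  have hn0 (e : X.E × Bool) : n e ≠ 0 := by
    intro h0
    have h := hn e
    rw [h0, zpow_zero] at h
    have h1 : zE e.1 = 1 := G.incl_injective e (h.trans (map_one _).symm)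
    exact one_ne_zero (hinjE e.1 (a₁ := 1) (a₂ := 0) (by simp [h1]))
  obtain ⟨d, k, hd0, hk0, hdk⟩ := GraphOfGroups.exists_weights hX n hn0 fun a l hl =>
    hG zV zE n hzVt hzEt hn a l hl fun e _ => (hE e.1).2
  have hincl (e : X.E × Bool) : G.incl e (zE e.1 ^ k e.1) = zV (X.tgt e) ^ d (X.tgt e) := by
    rw [map_zpow, hn, ← zpow_mul, hdk]
  have hCn (x) := Subgroup.zpowers_normal_of_zpowers_eq_top (hzVt x) (d x)
  have hDn (e) := Subgroup.zpowers_normal_of_zpowers_eq_top (hzEt e) (k e)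
  have hCD (e : X.E × Bool) : Subgroup.zpowers (zE e.1 ^ k e.1) =
      (Subgroup.zpowers (zV (X.tgt e) ^ d (X.tgt e))).comap (G.incl e) := by
    rw [← hincl, ← MonoidHom.map_zpowers,
      Subgroup.comap_map_eq_self_of_injective (G.incl_injective e)]
  have hconst := hT.eq_of_forall_edge (fun x => G.vertexHom T o x (zV x ^ d x)) fun e he => by
    have := GraphOfGroups.vertexHom_incl_of_mem (o := o) he (zE e ^ k e)
    rwa [hincl (e, true), hincl (e, false)] at this
  obtain ⟨⟨a⟩, -⟩ := id hX
  obtain ⟨c, hc⟩ : ∃ c, ∀ x, G.vertexHom T o x (zV x ^ d x) = c := ⟨_, fun x => hconst x a⟩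
  have hcenter : c ∈ Subgroup.center (G.FundamentalGroup T o) := by
    refine GraphOfGroups.mem_center_of_commute (fun x g => ?_) fun e => ?_
    · obtain ⟨i, rfl⟩ := hzV x g
      rw [← hc x]
      exact ((Commute.refl (zV x)).zpow_zpow _ _).map _
    · have := GraphOfGroups.letter_mul_vertexHom_incl (G := G) (o := o) e (zE e.1 ^ k e.1)
      rw [hincl (e.1, o e), hincl (e.1, !o e), hc, hc] at this
      exact (mul_inv_eq_iff_eq_mul.1 this).symm
  have hNc : Subgroup.zpowers c ≤ Subgroup.center (G.FundamentalGroup T o) :=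
    Subgroup.zpowers_le.2 hcenter
  have hNn : (Subgroup.zpowers c).Normal :=
    ⟨fun g hg b => by rwa [Subgroup.mem_center_iff.1 (hNc hg) b, mul_inv_cancel_right]⟩
  refine ⟨Subgroup.zpowers c, hNc, inferInstance, ?_, hNn, X, G.quotient _ _ hCD, T, o, hXV, hXE,
    hX, fun x => finite_quotient_zpowers_of_zpowers_eq_top (hzVt x) (hd0 x),
    fun e => finite_quotient_zpowers_of_zpowers_eq_top (hzEt e) (hk0 e), hT,
    ⟨GraphOfGroups.quotientEquiv _ _ hCD _ (fun x => ?_) ?_⟩⟩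
  · have hord (x) : orderOf (Multiplicative.ofAdd (1 / d x : ℚ)) ∣ orderOf (zV x) := by
      have := (hV x).2
      rw [Infinite.orderOf_eq_zero_of_forall_mem_zpowers (hzV x)]
      exact dvd_zero _
    let f (x) : G.vertexGroup x →* Multiplicative ℚ := monoidHomOfForallMemZpowers (hzV x) (hord x)
    have hf (x) (i : ℤ) : f x (zV x ^ i) = Multiplicative.ofAdd (i / d x : ℚ) := by
      have h1 : f x (zV x) = Multiplicative.ofAdd (1 / d x : ℚ) :=
        monoidHomOfForallMemZpowers_apply_gen (hzV x) (hord x)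
      rw [map_zpow, h1, ← ofAdd_zsmul, zsmul_eq_mul, mul_one_div]
    have hfe (e : X.E × Bool) (i : ℤ) :
        f _ (G.incl e (zE e.1 ^ i)) = Multiplicative.ofAdd (i / k e.1 : ℚ) := by
      have h1 : (n e : ℚ) ≠ 0 := Int.cast_ne_zero.2 (hn0 e)
      rw [map_zpow, hn, ← zpow_mul, hf, hdk, Int.cast_mul, Int.cast_mul,
        mul_div_mul_left _ _ h1]
    let F : G.FundamentalGroup T o →* Multiplicative ℚ := GraphOfGroups.lift f (fun _ => 1)
      (fun e _ g => by
        obtain ⟨i, rfl⟩ := hzE e g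
        exact (hfe (e, true) i).trans (hfe (e, false) i).symm)
      (fun e g => by
        obtain ⟨i, rfl⟩ := hzE e.1 g
        rw [one_mul, inv_one, mul_one]
        exact (hfe (e.1, o e) i).trans (hfe (e.1, !o e) i).symm)
    have hF : F c = Multiplicative.ofAdd 1 := by
      rw [← hc a, GraphOfGroups.lift_vertexHom, hf, div_self (Int.cast_ne_zero.2 (hd0 a))]
    refine Set.Infinite.to_subtype ((infinite_zpowers (a := c)).2 fun hfin => ?_)
    obtain ⟨m, hm, hcm⟩ := isOfFinOrder_iff_pow_eq_one.1 hfin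
    have := congrArg F hcm
    rw [map_pow, hF, map_one F, ← ofAdd_nsmul, ofAdd_eq_one, nsmul_one] at this
    exact hm.ne' (Nat.cast_eq_zero.1 this)
  · rw [Subgroup.zpowers_le, Subgroup.mem_comap, hc]
    exact Subgroup.mem_zpowers c
  · rw [Subgroup.zpowers_le, MonoidHom.mem_ker, ← hc a, GraphOfGroups.toQuotient_vertexHom]
    have h1 : GraphOfGroups.quotientMk (fun x => Subgroup.zpowers (zV x ^ d x))
        (fun e => Subgroup.zpowers (zE e ^ k e)) hCD a (zV a ^ d a) = 1 :=
      (QuotientGroup.eq_one_iff _).2 (Subgroup.mem_zpowers (zV a ^ d a))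
    rw [h1, map_one]
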